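/- Let $0<\varepsilon_0<1/2$. There is a constant $C>0$, depending only on $\varepsilon_0$, such that the following holds for all $q\in(0,2)$, $\varepsilon\in(0,\varepsilon_0]$, $\delta>0$, $d\in\mathbb N$, $s\in\mathbb R$. Let $$m=\max\{u\in\{1,\dots,d\}:\ \varepsilon^2u^{2/q-1}\le s^2\}$$ (with $m=0$ if there is no such $u$), and let $n$ be any non-negative integer with $$n\ \ge\ \frac{C}{\varepsilon^2}\Big(m\log\frac d\varepsilon+\log\frac1\delta\Big)$$ (if $d=0$, the term $m\log(d/\varepsilon)$ is read as $0$). Then there is an estimator, i.e. a measurable function $A:(\mathbb R^d)^n\to\mathbb R^d$, which may depend on $n,d,q,s,\varepsilon,\delta$, such that for every unknown $\mu\in\mathbb R^d$ with $\|\mu\|_q=(\sum_i|\mu_i|^q)^{1/q}\le s$ the following is true. If $X_1,\dots,X_n$ are i.i.d. samples from $N(\mu,I_d)$, and $\tilde X_1,\dots,\tilde X_n$ arise from them by modifying at most $\varepsilon n$ of the samples, the choice and the new values being arbitrary (they may depend on all samples, on $\mu$, on $A$ and on additional randomness), then with probability at least $1-\delta$ the output $\mu'=A(\tilde X_1,\dots,\tilde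 X_n)$ satisfies $\|\mu'-\mu\|_2\le C\varepsilon$. -/

import Mathlib

open MeasureTheory ProbabilityTheory

universe u

/-- The `ℓ_q` (quasi-)norm `‖v‖_q = (∑ i, |v i| ^ q) ^ (1 / q)` of a vector of `ℝ^d`. -/
noncomputable def lqNorm {d : ℕ} (q : ℝ) (v : EuclideanSpace ℝ (Fin d)) : ℝ :=
  (∑ i, |v i| ^ q) ^ (1 / q)

/-- The effective sparsity `max {u ∈ {1, …, d} : ε² u^(2/q - 1) ≤ s²}`; it is `0` if there is no
such `u`. -/
noncomputable def effectiveSparsity (d : ℕ) (q ε s : ℝ) : ℕ :=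
  sSup {u : ℕ | 1 ≤ u ∧ u ≤ d ∧ ε ^ 2 * (u : ℝ) ^ (2 / q - 1) ≤ s ^ 2}

/-- The data set `y` arises from the data set `x` of `n` points by modifying arbitrarily at most
`ε n` of the points. -/
def IsCorruption {n : ℕ} {E : Type*} (ε : ℝ) (x y : Fin n → E) : Prop :=
  (({i | y i ≠ x i} : Set (Fin n)).ncard : ℝ) ≤ ε * n

/-- The estimator `A` is given `n` samples. If they are an `ε`-corruption of independent samples
from `N(μ, I_d)`, then `A` outputs a vector at Euclidean distance at most `r` from `μ`, except with
probability at most `δ`. The adversary that produces the corrupted data set `Y` is arbitrary: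
`Y` may depend on all the clean samples, on `μ`, on `A` and on further randomness (`Ω` is an
arbitrary probability space), and need not even be measurable, in which case `P` is the outer
measure of the failure event. -/
def EstimatesMeanUnderCorruption {d n : ℕ}
    (A : (Fin n → EuclideanSpace ℝ (Fin d)) → EuclideanSpace ℝ (Fin d))
    (μ : EuclideanSpace ℝ (Fin d)) (ε δ r : ℝ) : Prop :=
  ∀ (Ω : Type u) [MeasurableSpace Ω] (P : Measure Ω) [IsProbabilityMeasure P]
    (X Y : Fin n → Ω → EuclideanSpace ℝ (Fin d)),
    (∀ i, HasLaw (X i) (multivariateGaussian μ 1) P) →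
    iIndepFun X P →
    (∀ ω, IsCorruption ε (fun i => X i ω) (fun i => Y i ω)) →
    P {ω | r < ‖A (fun i => Y i ω) - μ‖} ≤ ENNReal.ofReal δ

/-! Cutting off the small coordinates of `μ` moves it by at most `ε` and leaves at most `m` nonzero
coordinates, so it suffices to find an `m`-sparse vector close to `μ` in every direction relevant
for such vectors. The estimator selects a sparse candidate `u` that passes a one-sided median test
in finitely many directions: fewer than half of the data lie more than `T`, a multiple of `ε`, above
`u`.

Two facts make this work. By concavity of the Gaussian mass of `(0, x]`, a clean sample exceeds `μ`
by `t ε` in a given direction with probability at most `1/2 - (1 + a) ε`. Hoeffding's inequality at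
deviation `a ε` and a union bound keep the clean count below `(1/2 - ε) n` in all directions, so
corrupting `ε n` points cannot reach one half (`isCompatible_of_isCorruption`). Conversely, two
candidates passing the test differ by at most `2 T` along each direction
(`IsCompatible.inner_sub_le`).

The directions are integer vectors of `ℓ₁`-norm at most `4 m`. There are at most `(2 d + 1) ^ (4 m)`
of them, and one makes an angle of at most `π / 3` with any given nonzero difference of two
candidates (`exists_signedSum_inner_ge`); hence such candidates are within `4 T`. -/

/-! ### Gaussian tails and projections -/

/-- The part of a centred Gaussian lying in `(0, x]` as an integral over the unit interval. -/
theorem gaussianReal_Ioc_eq_integral {x : ℝ} (hx : 0 ≤ x) :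
    (gaussianReal 0 1).real (Set.Ioc 0 x) = x * ∫ y in (0 : ℝ)..1, gaussianPDFReal 0 1 (x * y) := by
  rw [measureReal_def, gaussianReal_apply_eq_integral 0 one_ne_zero, ENNReal.toReal_ofReal
    (integral_nonneg fun y => gaussianPDFReal_nonneg 0 1 y), ← intervalIntegral.integral_of_le hx,
    intervalIntegral.mul_integral_comp_mul_left]
  simp

theorem gaussianPDFReal_le_of_abs_le {x y : ℝ} (h : |x| ≤ |y|) :
    gaussianPDFReal 0 1 y ≤ gaussianPDFReal 0 1 x := by
  simp only [gaussianPDFReal]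
  have := sq_le_sq.2 h
  rw [sub_zero, sub_zero]
  gcongr

theorem continuous_gaussianPDFReal_std : Continuous (gaussianPDFReal 0 1) := by
  rw [gaussianPDFReal_def]
  fun_prop

/-- The mass that a centred Gaussian gives to `(0, x]` is concave in `x`. -/
theorem mul_gaussianReal_Ioc_le {c x : ℝ} (hc : 0 ≤ c) (hc1 : c ≤ 1) (hx : 0 ≤ x) :
    c * (gaussianReal 0 1).real (Set.Ioc 0 x) ≤ (gaussianReal 0 1).real (Set.Ioc 0 (c * x)) := by
  rw [gaussianReal_Ioc_eq_integral hx, gaussianReal_Ioc_eq_integral (by positivity), mul_assoc]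
  have hi (z : ℝ) : IntervalIntegrable (fun y => gaussianPDFReal 0 1 (z * y)) volume 0 1 :=
    (continuous_gaussianPDFReal_std.comp (continuous_const.mul continuous_id)).intervalIntegrable _ _
  gcongr
  refine intervalIntegral.integral_mono_on zero_le_one (hi _) (hi _) fun y hy => ?_
  apply gaussianPDFReal_le_of_abs_le
  rw [abs_mul, abs_mul, abs_mul, abs_of_nonneg hc, mul_assoc]
  exact mul_le_of_le_one_left (by positivity) hc1

theorem gaussianReal_Ioi_zero : (gaussianReal 0 1).real (Set.Ioi 0) = 1 / 2 := by
  have : NullSingletonClass (gaussianReal 0 1) := nullSingletonClass_gaussianReal one_ne_zero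
  have h1 : (gaussianReal 0 1).real (Set.Iio 0) = (gaussianReal 0 1).real (Set.Ioi 0) := by
    have h := gaussianReal_map_neg (μ := 0) (v := 1)
    rw [neg_zero] at h
    conv_rhs => rw [← h]
    rw [map_measureReal_apply measurable_neg measurableSet_Ioi]
    congr 1
    ext x
    simp
  have h2 : (gaussianReal 0 1).real (Set.Ici 0) = (gaussianReal 0 1).real (Set.Ioi 0) :=
    measureReal_congr Ioi_ae_eq_Ici.symm
  have h3 := probReal_add_probReal_compl (μ := gaussianReal 0 1) (s := Set.Iio 0) measurableSet_Iio
  rw [Set.compl_Iio, h1, h2] at h3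
  linarith

theorem gaussianReal_Ioi_eq {x : ℝ} (hx : 0 ≤ x) :
    (gaussianReal 0 1).real (Set.Ioi x) = 1 / 2 - (gaussianReal 0 1).real (Set.Ioc 0 x) := by
  have hdisj : Disjoint (Set.Ioc 0 x) (Set.Ioi x) := Set.disjoint_left.2 fun y hy => not_lt.2 hy.2
  rw [← gaussianReal_Ioi_zero, ← Set.Ioc_union_Ioi_eq_Ioi hx,
    measureReal_union hdisj measurableSet_Ioi]
  ring

theorem exists_gaussianReal_Ioi_lt {η : ℝ} (hη : 0 < η) :
    ∃ x : ℝ, 0 < x ∧ (gaussianReal 0 1).real (Set.Ioi x) < η := by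
  have h := tendsto_cdf_atTop (gaussianReal 0 1)
  obtain ⟨x, hx, hx0⟩ := ((h.eventually (lt_mem_nhds (show 1 - η < 1 by linarith))).and
    (Filter.eventually_gt_atTop 0)).exists
  refine ⟨x, hx0, ?_⟩
  rw [cdf_eq_real] at hx
  have h3 := probReal_add_probReal_compl (μ := gaussianReal 0 1) (s := Set.Iic x) measurableSet_Iic
  rw [Set.compl_Iic] at h3
  linarith

/-- For a contamination rate `ε` bounded away from `1 / 2`, a standard Gaussian exceeds `t ε` with
probability below `1 / 2 - ε` by a margin proportional to `ε`. -/
theorem exists_gaussianReal_Ioi_le {ε₀ : ℝ} (h0 : 0 < ε₀) (hε₀ : ε₀ < 1 / 2) :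
    ∃ a t : ℝ, 0 < a ∧ 0 < t ∧ ∀ ε : ℝ, 0 < ε → ε ≤ ε₀ →
      (gaussianReal 0 1).real (Set.Ioi (t * ε)) ≤ 1 / 2 - (1 + a) * ε := by
  -- This choice makes `(1 + a) * ε₀` the midpoint of `ε₀` and `1 / 2`. A tail point `x` for `ε₀`
  -- then serves every smaller `ε` after scaling by `ε / ε₀`, by concavity.
  set a : ℝ := (1 / 2 - ε₀) / (2 * ε₀) with ha
  have hapos : 0 < a := by apply div_pos <;> linarith
  have haε : (1 + a) * ε₀ = (1 / 2 + ε₀) / 2 := by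
    rw [ha]; field_simp; ring
  obtain ⟨x, hx, hlt⟩ := exists_gaussianReal_Ioi_lt (η := 1 / 2 - (1 + a) * ε₀) (by linarith)
  refine ⟨a, x / ε₀, hapos, by positivity, fun ε hε hle => ?_⟩
  rw [gaussianReal_Ioi_eq hx.le] at hlt
  rw [gaussianReal_Ioi_eq (by positivity)]
  have h := mul_gaussianReal_Ioc_le (c := ε / ε₀) (by positivity) (by rwa [div_le_one h0]) hx.le
  have h2 : (1 + a) * ε = ε / ε₀ * ((1 + a) * ε₀) := by field_simp
  have h3 : ε / ε₀ * ((1 + a) * ε₀) ≤ ε / ε₀ * (gaussianReal 0 1).real (Set.Ioc 0 x) := by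
    gcongr; linarith
  have h4 : x / ε₀ * ε = ε / ε₀ * x := by ring
  rw [h4, h2]
  linarith

/-- One-dimensional projections of `N(μ, I)` are Gaussian. -/
theorem multivariateGaussian_real_inner_gt {d : ℕ} (μ z : EuclideanSpace ℝ (Fin d)) (hz : z ≠ 0)
    (c : ℝ) :
    (multivariateGaussian μ 1).real {x | c * ‖z‖ < inner ℝ (x - μ) z} =
      (gaussianReal 0 1).real (Set.Ioi c) := by
  have hz' : 0 < ‖z‖ := norm_pos_iff.2 hz
  set L : StrongDual ℝ (EuclideanSpace ℝ (Fin d)) := innerSL ℝ (‖z‖⁻¹ • z) with hL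
  have hLx (x) : L x = ‖z‖⁻¹ * inner ℝ x z := by
    rw [hL, innerSL_apply_apply, real_inner_smul_left, real_inner_comm]
  have hmean : ∫ x, L x ∂(multivariateGaussian μ 1) = L μ := by
    rw [L.integral_comp_id_comm IsGaussian.integrable_id, integral_id_multivariateGaussian]
  have hvar : Var[L; multivariateGaussian μ 1] = 1 := by
    have h := covarianceBilin_multivariateGaussian (μ := μ) (S := 1) Matrix.PosSemidef.one
      (‖z‖⁻¹ • z) (‖z‖⁻¹ • z)
    rw [covarianceBilin_self IsGaussian.memLp_two_id, Matrix.one_mulVec] at h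
    refine h.trans ?_
    have h2 := EuclideanSpace.inner_eq_star_dotProduct (𝕜 := ℝ) (‖z‖⁻¹ • z) (‖z‖⁻¹ • z)
    rw [star_trivial] at h2
    rw [← h2, real_inner_self_eq_norm_sq, norm_smul, norm_inv, norm_norm, inv_mul_cancel₀ hz'.ne',
      one_pow]
  have hmap := IsGaussian.map_eq_gaussianReal (μ := multivariateGaussian μ 1) L
  rw [hmean, hvar, Real.toNNReal_one] at hmap
  have hadd := gaussianReal_map_const_add (μ := 0) (v := 1) (L μ)
  rw [zero_add, ← hmap] at hadd
  have hset : {x | c * ‖z‖ < inner ℝ (x - μ) z} = L ⁻¹' Set.Ioi (L μ + c) := by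
    ext x
    simp only [Set.mem_ofPred_eq, Set.mem_preimage, Set.mem_Ioi]
    rw [← lt_sub_iff_add_lt', ← map_sub, hLx, lt_inv_mul_iff₀ hz', mul_comm]
  rw [hset, ← map_measureReal_apply L.continuous.measurable measurableSet_Ioi, ← hadd,
    map_measureReal_apply (measurable_const_add _) measurableSet_Ioi]
  congr 1
  ext x
  simp

/-! ### Concentration of counts -/

/-- Hoeffding's inequality for the number of independent samples that fall into a set. -/
theorem measureReal_card_mem_ge_le {Ω E : Type*} [MeasurableSpace Ω] [MeasurableSpace E]
    {P : Measure Ω} [IsProbabilityMeasure P] {ν : Measure E} {n : ℕ} {X : Fin n → Ω → E}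
    (hlaw : ∀ i, HasLaw (X i) ν P) (hind : iIndepFun X P) {B : Set E} (hB : MeasurableSet B)
    {p τ : ℝ} (hp : ν.real B ≤ p) (hτ : 0 ≤ τ) :
    P.real {ω | (p + τ) * n ≤ ({i | X i ω ∈ B} : Set (Fin n)).ncard} ≤ Real.exp (-2 * τ ^ 2 * n) := by
  set f : E → ℝ := B.indicator 1 with hf
  have hfm : Measurable f := measurable_one.indicator hB
  have hmean (i) : P[fun ω => f (X i ω)] = ν.real B := by
    rw [← (hlaw i).map_eq, ← integral_indicator_one hB,
      integral_map (hlaw i).aemeasurable hfm.aestronglyMeasurable]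
  have hsub (i) : HasSubgaussianMGF (fun ω => f (X i ω) - ν.real B) ((‖(1 : ℝ) - 0‖₊ / 2) ^ 2) P := by
    rw [← hmean i]
    refine hasSubgaussianMGF_of_mem_Icc (hfm.comp_aemeasurable (hlaw i).aemeasurable)
      (Filter.Eventually.of_forall fun ω => ?_)
    by_cases h : X i ω ∈ B <;> simp [hf, h]
  have hind' : iIndepFun (fun i ω => f (X i ω) - ν.real B) P :=
    hind.comp (fun _ x => f x - ν.real B) fun _ => hfm.sub_const _
  have h := HasSubgaussianMGF.measure_sum_ge_le_of_iIndepFun hind' (s := Finset.univ)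
    (fun i _ => hsub i) (ε := τ * n) (by positivity)
  refine (measureReal_mono ?_).trans (h.trans_eq ?_)
  · intro ω hω
    simp only [Set.mem_ofPred_eq] at hω ⊢
    have hcount : ∑ i, f (X i ω) = ({i | X i ω ∈ B} : Set (Fin n)).ncard := by
      classical
      rw [Set.ncard_eq_toFinset_card']
      simp [hf, Set.indicator_apply]
    rw [Finset.sum_sub_distrib, hcount]
    simp only [Finset.sum_const, Finset.card_univ, Fintype.card_fin, nsmul_eq_mul]
    have : (n : ℝ) * ν.real B ≤ n * p := by gcongr
    linarith
  · congr 1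
    -- Indicators have sub-Gaussian parameter `1 / 4`, so the exponent is `(τ n)² / (2 · n / 4) = 2
    -- τ² n`; the quotient needs `n ≠ 0`.
    rcases Nat.eq_zero_or_pos n with rfl | hn
    · simp
    · have : (0 : ℝ) < n := by exact_mod_cast hn
      simp
      field_simp

/-! ### The finite set of test directions -/

/-- The signed coordinate vectors of `ℤ^d`, together with `0`. -/
def signedUnit {d : ℕ} : Option (Fin d × Bool) → Fin d → ℤ
  | none => 0
  | some (i, b) => Pi.single i (if b then 1 else -1)

/-- An integer vector of `ℓ₁`-norm at most `L` is a sum of `L` vectors from `{0, ±e_i}`. -/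
theorem exists_sum_signedUnit_eq {d : ℕ} (L : ℕ) (a : Fin d → ℤ) (ha : ∑ i, (a i).natAbs ≤ L) :
    ∃ f : Fin L → Option (Fin d × Bool), ∑ j, signedUnit (f j) = a := by
  induction L generalizing a with
  | zero =>
    refine ⟨Fin.elim0, ?_⟩
    ext i
    have := Finset.single_le_sum (f := fun i => (a i).natAbs) (fun _ _ => Nat.zero_le _)
      (Finset.mem_univ i)
    simp only [Finset.univ_eq_empty, Finset.sum_empty, Pi.zero_apply]
    omega
  | succ L ih =>
    by_cases h0 : a = 0
    · exact ⟨fun _ => none, by simp [signedUnit, h0]⟩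
    · obtain ⟨i, hi⟩ := Function.ne_iff.1 h0
      simp only [Pi.zero_apply] at hi
      -- Subtracting `±e_i` with the sign of `a i` lowers the `ℓ₁`-norm.
      set o : Option (Fin d × Bool) := some (i, decide (0 < a i)) with ho
      have hval (j) : signedUnit o j = if j = i then (if 0 < a i then 1 else -1) else 0 := by
        simp [ho, signedUnit, Pi.single_apply]
      have hlt : ∑ j, ((a - signedUnit o) j).natAbs < ∑ j, (a j).natAbs := by
        apply Finset.sum_lt_sum
        · intro j _
          rw [Pi.sub_apply, hval]
          split_ifs with h1 h2
          · subst h1; omega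
          · subst h1; omega
          · simp
        · refine ⟨i, Finset.mem_univ i, ?_⟩
          rw [Pi.sub_apply, hval]
          split_ifs <;> omega
      obtain ⟨f, hf⟩ := ih (a - signedUnit o) (by omega)
      refine ⟨Fin.cons o f, ?_⟩
      rw [Fin.sum_univ_succ]
      simp [hf]

/-- The sum of a family of signed coordinate vectors, in Euclidean space. -/
noncomputable def signedSum {d L : ℕ} (f : Fin L → Option (Fin d × Bool)) :
    EuclideanSpace ℝ (Fin d) :=
  WithLp.toLp 2 fun i => (((∑ j, signedUnit (f j)) i : ℤ) : ℝ)

/-- The number of nonzero coordinates. -/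
noncomputable def supportCard {d : ℕ} (w : EuclideanSpace ℝ (Fin d)) : ℕ :=
  (Finset.univ.filter fun i => w i ≠ 0).card

theorem supportCard_sub_le {d : ℕ} (v w : EuclideanSpace ℝ (Fin d)) :
    supportCard (v - w) ≤ supportCard v + supportCard w := by
  classical
  refine (Finset.card_le_card (t := (Finset.univ.filter fun i => v i ≠ 0) ∪
    (Finset.univ.filter fun i => w i ≠ 0)) fun i => ?_).trans (Finset.card_union_le _ _)
  rw [Finset.mem_union, Finset.mem_filter_univ, Finset.mem_filter_univ, Finset.mem_filter_univ,
    PiLp.sub_apply]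
  intro h
  by_contra! hc
  exact h (by rw [hc.1, hc.2, sub_zero])

theorem sum_abs_le_sqrt_mul_norm {d k : ℕ} {w : EuclideanSpace ℝ (Fin d)} (hw : supportCard w ≤ k) :
    ∑ i, |w i| ≤ √k * ‖w‖ := by
  have h1 : ∑ i, |w i| = ∑ i ∈ Finset.univ.filter (fun i => w i ≠ 0), |w i| := by
    rw [Finset.sum_filter]
    refine Finset.sum_congr rfl fun i _ => ?_
    split_ifs with h
    · rfl
    · simp [not_not.1 h]
  rw [EuclideanSpace.norm_eq, ← Real.sqrt_mul (Nat.cast_nonneg k)]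
  apply Real.le_sqrt_of_sq_le
  rw [h1]
  refine sq_sum_le_card_mul_sum_sq.trans ?_
  simp only [sq_abs, Real.norm_eq_abs]
  apply mul_le_mul
  · exact Nat.cast_le.2 hw
  · exact Finset.sum_le_sum_of_subset_of_nonneg (Finset.filter_subset _ _) fun _ _ _ => sq_nonneg _
  · positivity
  · positivity

/-- Rounding towards zero. -/
theorem exists_int_round_toward_zero (x : ℝ) :
    ∃ a : ℤ, |(a : ℝ)| ≤ |x| ∧ |x| * (|x| - 1) ≤ a * x := by
  rcases le_total 0 x with hx | hx
  · refine ⟨⌊x⌋, ?_, ?_⟩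
    · rw [abs_of_nonneg hx, abs_of_nonneg (by exact_mod_cast Int.floor_nonneg.2 hx)]
      exact Int.floor_le x
    · rw [abs_of_nonneg hx]
      nlinarith [Int.lt_floor_add_one x]
  · refine ⟨-⌊-x⌋, ?_, ?_⟩
    · push_cast
      rw [abs_neg, abs_of_nonpos hx,
        abs_of_nonneg (by exact_mod_cast Int.floor_nonneg.2 (neg_nonneg.2 hx))]
      exact Int.floor_le (-x)
    · rw [abs_of_nonpos hx]
      push_cast
      nlinarith [Int.lt_floor_add_one (-x)]

/-- The sums of `2 k` vectors from `{0, ±e_i}` form a finite symmetric set that contains a vector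
at angle at most `π / 3` with any given `k`-sparse vector. -/
theorem exists_signedSum_inner_ge {d k : ℕ} {w : EuclideanSpace ℝ (Fin d)} (hw : supportCard w ≤ k)
    (hw0 : w ≠ 0) :
    ∃ f g : Fin (2 * k) → Option (Fin d × Bool), signedSum g = -signedSum f ∧ signedSum f ≠ 0 ∧
      ‖w‖ * ‖signedSum f‖ / 2 ≤ inner ℝ w (signedSum f) := by
  have hwpos : 0 < ‖w‖ := norm_pos_iff.2 hw0
  have hk : 0 < k := by
    refine lt_of_lt_of_le (Finset.card_pos.2 ?_) hw
    by_contra h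
    rw [Finset.not_nonempty_iff_eq_empty, Finset.filter_eq_empty_iff] at h
    exact hw0 (by ext i; simpa using h (Finset.mem_univ i))
  have hk' : (0 : ℝ) < √k := Real.sqrt_pos.2 (by exact_mod_cast hk)
  -- The direction is `r w` rounded towards zero. With `r ‖w‖ = 2 √k`, its `ℓ₁`-norm is at most `2
  -- k` by Cauchy–Schwarz, and rounding costs the inner product with `w` at most `∑ |w i| ≤ √k ‖w‖`,
  -- half of `r ‖w‖²`.
  set r : ℝ := 2 * √k / ‖w‖ with hr
  have hrpos : 0 < r := by positivity
  have hrw : r * ‖w‖ = 2 * √k := by rw [hr]; field_simp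
  choose a ha1 ha2 using fun i => exists_int_round_toward_zero (r * w i)
  have hl1 := sum_abs_le_sqrt_mul_norm hw
  have hsum : ∑ i, (a i).natAbs ≤ 2 * k := by
    have h : ((∑ i, (a i).natAbs : ℕ) : ℝ) ≤ ((2 * k : ℕ) : ℝ) := by
      push_cast
      calc ∑ i, ((a i).natAbs : ℝ) ≤ ∑ i, r * |w i| := by
            refine Finset.sum_le_sum fun i _ => ?_
            rw [Nat.cast_natAbs, Int.cast_abs]
            simpa [abs_mul, abs_of_pos hrpos] using ha1 i
        _ = r * ∑ i, |w i| := by rw [Finset.mul_sum]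
        _ ≤ r * (√k * ‖w‖) := by gcongr
        _ = √k * (r * ‖w‖) := by ring
        _ = 2 * (√k * √k) := by rw [hrw]; ring
        _ = 2 * k := by rw [Real.mul_self_sqrt (Nat.cast_nonneg k)]
    exact_mod_cast h
  obtain ⟨f, hf⟩ := exists_sum_signedUnit_eq _ a hsum
  obtain ⟨g, hg⟩ := exists_sum_signedUnit_eq (2 * k) (-a) (by simpa using hsum)
  have hfi (i) : signedSum f i = a i := by simp only [signedSum, hf]
  have hgi (i) : signedSum g i = -a i := by simp only [signedSum, hg]; simp
  have hnorm : ‖signedSum f‖ ≤ 2 * √k := by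
    rw [← hrw, ← abs_of_pos hrpos, ← Real.norm_eq_abs, ← norm_smul, EuclideanSpace.norm_eq,
      EuclideanSpace.norm_eq]
    apply Real.sqrt_le_sqrt
    refine Finset.sum_le_sum fun i _ => ?_
    rw [hfi, PiLp.smul_apply, smul_eq_mul, Real.norm_eq_abs, Real.norm_eq_abs]
    have := ha1 i
    gcongr
  have hinner : √k * ‖w‖ ≤ inner ℝ w (signedSum f) := by
    have h1 : r * ‖w‖ ^ 2 - ∑ i, |w i| ≤ inner ℝ w (signedSum f) := by
      rw [EuclideanSpace.real_norm_sq_eq, PiLp.inner_apply, Finset.mul_sum, ← Finset.sum_sub_distrib]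
      refine Finset.sum_le_sum fun i _ => ?_
      rw [hfi]
      have h := ha2 i
      rw [abs_mul, abs_of_pos hrpos, mul_assoc, mul_left_comm (a i : ℝ)] at h
      have h2 := le_of_mul_le_mul_left h hrpos
      rw [← sq_abs]
      change _ ≤ (a i : ℝ) * w i
      linarith
    have h2 : r * ‖w‖ ^ 2 = 2 * √k * ‖w‖ := by rw [sq, ← mul_assoc, hrw]
    linarith
  refine ⟨f, g, ?_, ?_, ?_⟩
  · ext i
    rw [hgi, PiLp.neg_apply, hfi]
  · intro h
    rw [h, inner_zero_right] at hinner
    have : 0 < √k * ‖w‖ := by positivity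
    linarith
  · nlinarith

/-! ### Sparse approximation in the `ℓ_q` ball -/

theorem abs_rpow_sum_le_of_lqNorm_le {d : ℕ} {q s : ℝ} (hq : 0 < q) {μ : EuclideanSpace ℝ (Fin d)}
    (h : lqNorm q μ ≤ s) : 0 ≤ s ∧ ∑ i, |μ i| ^ q ≤ s ^ q := by
  have hS : 0 ≤ ∑ i, |μ i| ^ q := Finset.sum_nonneg fun i _ => by positivity
  have hN : 0 ≤ lqNorm q μ := Real.rpow_nonneg hS _
  refine ⟨hN.trans h, ?_⟩
  have h2 := Real.rpow_le_rpow hN h hq.le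
  rwa [lqNorm, ← Real.rpow_mul hS, one_div_mul_cancel hq.ne', Real.rpow_one] at h2

theorem lt_of_effectiveSparsity_lt {d : ℕ} {q ε s : ℝ} (h : effectiveSparsity d q ε s < d) :
    s ^ 2 < ε ^ 2 * ((effectiveSparsity d q ε s + 1 : ℕ) : ℝ) ^ (2 / q - 1) := by
  by_contra! hle
  have : effectiveSparsity d q ε s + 1 ≤ effectiveSparsity d q ε s :=
    le_csSup ⟨d, fun u hu => hu.2.1⟩ ⟨by omega, h, hle⟩
  omega

/-- A vector of the `ℓ_q` ball is `ε`-close to a vector whose support has at most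
`effectiveSparsity` elements. -/
theorem exists_sparse_approx {d : ℕ} {q ε s : ℝ} (hq : 0 < q) (hq2 : q < 2) (hε : 0 < ε)
    {μ : EuclideanSpace ℝ (Fin d)} (h : lqNorm q μ ≤ s) :
    ∃ u : EuclideanSpace ℝ (Fin d), supportCard u ≤ effectiveSparsity d q ε s ∧ ‖μ - u‖ ≤ ε := by
  obtain ⟨hs, hsum⟩ := abs_rpow_sum_le_of_lqNorm_le hq h
  rcases le_or_gt d (effectiveSparsity d q ε s) with hd | hd
  · refine ⟨μ, le_trans ?_ hd, by simpa using hε.le⟩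
    exact (Finset.card_le_univ _).trans_eq (Fintype.card_fin d)
  have hlt := lt_of_effectiveSparsity_lt hd
  set M : ℕ := effectiveSparsity d q ε s + 1 with hM
  have hMpos : (0 : ℝ) < M := by rw [hM]; positivity
  -- The threshold solves `M τ^q = s^q`, so fewer than `M` coordinates exceed it. The discarded ones
  -- have square sum at most `τ^(2-q) s^q = s² M^(1-2/q)`, which is at most `ε²` because `M` is one
  -- past the effective sparsity.
  set τ : ℝ := s * (M : ℝ) ^ (-1 / q) with hτ
  have hτ0 : 0 ≤ τ := by positivity
  have hτq : τ ^ q = s ^ q / M := by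
    rw [hτ, Real.mul_rpow hs (by positivity), ← Real.rpow_mul hMpos.le, div_mul_cancel₀ _ hq.ne',
      Real.rpow_neg_one, div_eq_mul_inv]
  refine ⟨WithLp.toLp 2 fun i => if τ < |μ i| then μ i else 0, ?_, ?_⟩
  · by_contra! hcard
    set T := Finset.univ.filter fun i => τ < |μ i| with hT
    have hMT : M ≤ T.card := by
      refine hcard.trans_le (Finset.card_le_card fun i => ?_)
      simp only [hT, Finset.mem_filter, Finset.mem_univ, true_and]
      intro hi
      by_contra hc
      simp [hc] at hi
    have hTne : T.Nonempty := Finset.card_pos.1 (by omega)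
    have h1 : ∑ i ∈ T, τ ^ q < ∑ i ∈ T, |μ i| ^ q := by
      refine Finset.sum_lt_sum_of_nonempty hTne fun i hi => ?_
      exact Real.rpow_lt_rpow hτ0 (Finset.mem_filter.1 hi).2 hq
    have h2 : ∑ i ∈ T, |μ i| ^ q ≤ ∑ i, |μ i| ^ q :=
      Finset.sum_le_sum_of_subset_of_nonneg (Finset.subset_univ _) fun i _ _ =>
        Real.rpow_nonneg (abs_nonneg _) _
    rw [Finset.sum_const, nsmul_eq_mul, hτq] at h1
    have h3 : s ^ q ≤ T.card * (s ^ q / M) := by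
      calc s ^ q = M * (s ^ q / M) := by field_simp
        _ ≤ _ := by gcongr
    linarith
  · rw [EuclideanSpace.norm_eq]
    apply Real.sqrt_le_iff.2 ⟨hε.le, ?_⟩
    have hterm (i) : ‖(μ - WithLp.toLp 2 fun i => if τ < |μ i| then μ i else 0) i‖ ^ 2 ≤
        τ ^ (2 - q) * |μ i| ^ q := by
      simp only [PiLp.sub_apply]
      split_ifs with hi
      · simpa using by positivity
      · rw [sub_zero, Real.norm_eq_abs]
        calc |μ i| ^ 2 = |μ i| ^ ((2 - q) + q) := by
              rw [← Real.rpow_natCast]; congr 1; push_cast; ring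
          _ = |μ i| ^ (2 - q) * |μ i| ^ q :=
              Real.rpow_add_of_nonneg (abs_nonneg _) (by linarith) hq.le
          _ ≤ _ := by
              gcongr
              linarith
    calc _ ≤ ∑ i, τ ^ (2 - q) * |μ i| ^ q := Finset.sum_le_sum fun i _ => hterm i
      _ = τ ^ (2 - q) * ∑ i, |μ i| ^ q := by rw [Finset.mul_sum]
      _ ≤ τ ^ (2 - q) * s ^ q := by gcongr
      _ = s ^ 2 * (M : ℝ) ^ (-(2 / q - 1)) := by
          rw [hτ, Real.mul_rpow hs (by positivity), ← Real.rpow_mul hMpos.le, mul_right_comm,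
            ← Real.rpow_add_of_nonneg hs (by linarith) hq.le, sub_add_cancel, Real.rpow_two]
          congr 2
          field_simp
      _ ≤ ε ^ 2 * (M : ℝ) ^ (2 / q - 1) * (M : ℝ) ^ (-(2 / q - 1)) := by gcongr
      _ = ε ^ 2 := by rw [mul_assoc, ← Real.rpow_add hMpos, add_neg_cancel, Real.rpow_zero, mul_one]

/-! ### The median test and its measurable selection -/

/-- The candidate mean `u` is compatible with the data `y` up to error `T` in the directions `V j`:
in each of them fewer than half of the data points lie further than `T` above `u`. -/
def IsCompatible {ι E : Type*} [NormedAddCommGroup E] [InnerProductSpace ℝ E] {n : ℕ} (V : ι → E)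
    (T : ℝ) (y : Fin n → E) (u : E) : Prop :=
  ∀ j, 2 * ({i | T * ‖V j‖ < inner ℝ (y i - u) (V j)} : Set (Fin n)).ncard < n

section

variable {ι E : Type*} [NormedAddCommGroup E] [InnerProductSpace ℝ E] {n : ℕ} {V : ι → E} {T : ℝ}
  {y : Fin n → E}

/-- Were the gap larger, each data point would lie more than `T` above `v` along `V j` or more than
`T` below `u`; two sets, each with fewer than half of the points, cannot cover all of them. The
second set is the test for `u` in the opposite direction. -/
theorem IsCompatible.inner_sub_le {u v : E} (hu : IsCompatible V T y u)
    (hv : IsCompatible V T y v) {j j' : ι} (hj : V j' = -V j) :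
    inner ℝ (u - v) (V j) ≤ 2 * T * ‖V j‖ := by
  by_contra! hlt
  have h1 := hv j
  have h2 := hu j'
  have hcover : (Set.univ : Set (Fin n)) ⊆
      {i | T * ‖V j‖ < inner ℝ (y i - v) (V j)} ∪ {i | T * ‖V j'‖ < inner ℝ (y i - u) (V j')} := by
    intro i _
    by_contra hc
    simp only [Set.mem_union, Set.mem_ofPred_eq, not_or, not_lt, hj, norm_neg, inner_neg_right] at hc
    have : inner ℝ (u - v) (V j) = inner ℝ (y i - v) (V j) + -inner ℝ (y i - u) (V j) := by
      simp only [inner_sub_left]; ring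
    linarith [hc.1, hc.2]
  have h3 := (Set.ncard_le_ncard hcover).trans (Set.ncard_union_le _ _)
  rw [Set.ncard_univ, Nat.card_eq_fintype_card, Fintype.card_fin] at h3
  omega

theorem measurableSet_isCompatible [Finite ι] [MeasurableSpace E] [BorelSpace E]
    [SecondCountableTopology E] (V : ι → E) (T : ℝ) (u : E) :
    MeasurableSet {y : Fin n → E | IsCompatible V T y u} := by
  classical
  simp only [IsCompatible, Set.ofPred_forall]
  refine MeasurableSet.iInter fun j => ?_
  have hinner (i : Fin n) : Measurable fun y : Fin n → E => inner ℝ (y i - u) (V j) :=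
    (((continuous_apply i).sub continuous_const).inner continuous_const).measurable
  have hcount : Measurable fun y : Fin n → E =>
      ({i | T * ‖V j‖ < inner ℝ (y i - u) (V j)} : Set (Fin n)).ncard := by
    have heq (y : Fin n → E) : ({i | T * ‖V j‖ < inner ℝ (y i - u) (V j)} : Set (Fin n)).ncard =
        ∑ i, {y : Fin n → E | T * ‖V j‖ < inner ℝ (y i - u) (V j)}.indicator 1 y := by
      rw [Set.ncard_eq_toFinset_card']
      simp [Set.indicator_apply]
    simp only [heq]
    refine Finset.measurable_sum _ fun i _ => measurable_one.indicator ?_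
    exact measurableSet_lt measurable_const (hinner i)
  exact measurableSet_lt (hcount.const_mul 2) measurable_const

/-- Measurable selection of a compatible candidate from a set, up to density. -/
theorem exists_measurable_compatible_selection [Finite ι] [MeasurableSpace E] [BorelSpace E]
    [SecondCountableTopology E] (V : ι → E) (T : ℝ) {S : Set E} (hS : S.Nonempty) :
    ∃ A : (Fin n → E) → E, Measurable A ∧ (∀ y, A y ∈ S) ∧
      ∀ u ∈ S, ∀ r > 0, ∃ v ∈ S, ‖u - v‖ < r ∧
        ∀ y, IsCompatible V T y v → IsCompatible V T y (A y) := by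
  classical
  have : Nonempty S := hS.to_subtype
  set c : ℕ → S := TopologicalSpace.denseSeq S with hc
  -- The second alternative makes the search for the least index total: it returns `0` if no
  -- candidate passes.
  have hex (y : Fin n → E) : ∃ k, IsCompatible V T y (c k) ∨ ∀ l, ¬ IsCompatible V T y (c l) := by
    by_cases h : ∃ k, IsCompatible V T y (c k)
    · exact h.imp fun k hk => Or.inl hk
    · exact ⟨0, Or.inr (not_exists.1 h)⟩
  have hmeas (k) : MeasurableSet
      {y : Fin n → E | IsCompatible V T y (c k) ∨ ∀ l, ¬ IsCompatible V T y (c l)} := by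
    rw [Set.ofPred_or, Set.ofPred_forall]
    exact (measurableSet_isCompatible V T _).union
      (MeasurableSet.iInter fun l => (measurableSet_isCompatible V T _).compl)
  refine ⟨fun y => c (Nat.find (hex y)), ?_, fun y => (c _).2, ?_⟩
  · exact (measurable_from_nat (f := fun k => (c k : E))).comp (measurable_find hex hmeas)
  · intro u hu r hr
    obtain ⟨k, hk⟩ := (TopologicalSpace.denseRange_denseSeq S).exists_dist_lt ⟨u, hu⟩ hr
    refine ⟨c k, (c k).2, by simpa [Subtype.dist_eq, dist_eq_norm] using hk, fun y hy => ?_⟩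
    exact (Nat.find_spec (hex y)).resolve_right fun h => h k hy

/-- If fewer than `(1 / 2 - ε) n` of the clean points exceed `μ` by more than `T` in each test
direction, then every point near `μ` is compatible with the corrupted data. -/
theorem isCompatible_of_isCorruption {x : Fin n → E} {μ u : E} {ε r : ℝ}
    (hxy : IsCorruption ε x y)
    (hx : ∀ j, (({i | T * ‖V j‖ < inner ℝ (x i - μ) (V j)} : Set (Fin n)).ncard : ℝ) <
      (1 / 2 - ε) * n) (hu : ‖μ - u‖ ≤ r) :
    IsCompatible V (T + r) y u := by
  intro j
  have hsub : ({i | (T + r) * ‖V j‖ < inner ℝ (y i - u) (V j)} : Set (Fin n)) ⊆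
      {i | T * ‖V j‖ < inner ℝ (x i - μ) (V j)} ∪ {i | y i ≠ x i} := by
    intro i hi
    by_contra hc
    simp only [Set.mem_union, Set.mem_ofPred_eq, not_or, not_lt, not_not] at hc hi
    rw [hc.2, ← sub_add_sub_cancel (x i) μ u, inner_add_left] at hi
    have h1 := real_inner_le_norm (μ - u) (V j)
    have h2 : ‖μ - u‖ * ‖V j‖ ≤ r * ‖V j‖ := by gcongr
    linarith [hc.1]
  have h3 := (Set.ncard_le_ncard hsub).trans (Set.ncard_union_le _ _)
  have h4 := hx j
  have h5 : (({i | (T + r) * ‖V j‖ < inner ℝ (y i - u) (V j)} : Set (Fin n)).ncard : ℝ) ≤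
    ({i | T * ‖V j‖ < inner ℝ (x i - μ) (V j)} : Set (Fin n)).ncard +
      ({i | y i ≠ x i} : Set (Fin n)).ncard := by exact_mod_cast h3
  have h6 : (({i | y i ≠ x i} : Set (Fin n)).ncard : ℝ) ≤ ε * n := hxy
  have h7 : ((2 * ({i | (T + r) * ‖V j‖ < inner ℝ (y i - u) (V j)} : Set (Fin n)).ncard : ℕ) : ℝ)
      < n := by
    push_cast
    linarith
  exact_mod_cast h7

end

/-! ### Accuracy, union bound and sample size -/

/-- Compatibility in the directions `signedSum` determines a sparse vector up to `4 T`. -/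
theorem IsCompatible.norm_sub_le {d n k : ℕ} {T : ℝ} (hT : 0 ≤ T)
    {y : Fin n → EuclideanSpace ℝ (Fin d)} {u v : EuclideanSpace ℝ (Fin d)}
    (hu : IsCompatible (signedSum (d := d) (L := 2 * (k + k))) T y u)
    (hv : IsCompatible (signedSum (d := d) (L := 2 * (k + k))) T y v)
    (hku : supportCard u ≤ k) (hkv : supportCard v ≤ k) : ‖u - v‖ ≤ 4 * T := by
  by_cases h0 : u - v = 0
  · rw [h0, norm_zero]; positivity
  obtain ⟨f, g, hg, hf0, hf⟩ := exists_signedSum_inner_ge (k := k + k)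
    ((supportCard_sub_le u v).trans (add_le_add hku hkv)) h0
  have h := hf.trans (hu.inner_sub_le hv hg)
  have hpos : 0 < ‖signedSum f‖ := norm_pos_iff.2 hf0
  refine le_of_mul_le_mul_right ?_ hpos
  linarith

/-- With high probability, in no test direction do many clean samples exceed the mean by much. -/
theorem measureReal_exists_card_ge_le {Ω : Type*} [MeasurableSpace Ω] {P : Measure Ω}
    [IsProbabilityMeasure P] {d n : ℕ} {μ : EuclideanSpace ℝ (Fin d)}
    {X : Fin n → Ω → EuclideanSpace ℝ (Fin d)} (hlaw : ∀ i, HasLaw (X i) (multivariateGaussian μ 1) P)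
    (hind : iIndepFun X P) {ι : Type*} [Fintype ι] (V : ι → EuclideanSpace ℝ (Fin d)) {c p τ : ℝ}
    (hτ : 0 ≤ τ) (hp : (gaussianReal 0 1).real (Set.Ioi c) ≤ p) :
    P.real {ω | ∃ j, (p + τ) * n ≤
      ({i | c * ‖V j‖ < inner ℝ (X i ω - μ) (V j)} : Set (Fin n)).ncard} ≤
      Fintype.card ι * Real.exp (-2 * τ ^ 2 * n) := by
  rw [Set.ofPred_exists]
  refine (measureReal_iUnion_fintype_le _).trans ?_
  rw [← Finset.card_univ, ← nsmul_eq_mul]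
  refine Finset.sum_le_card_nsmul _ _ _ fun j _ => ?_
  set B : Set (EuclideanSpace ℝ (Fin d)) := {x | c * ‖V j‖ < inner ℝ (x - μ) (V j)} with hB
  have hBm : MeasurableSet B :=
    measurableSet_lt measurable_const ((measurable_id.sub_const μ).inner measurable_const)
  refine measureReal_card_mem_ge_le hlaw hind hBm ?_ hτ
  by_cases h0 : V j = 0
  · have : B = ∅ := by simp [hB, h0]
    rw [this, measureReal_empty]
    exact measureReal_nonneg.trans hp
  · rwa [hB, multivariateGaussian_real_inner_gt μ _ h0]

/-- Since `2 d + 1 ≤ (d / ε)²` for `d ≥ 1`, the logarithm of the number of directions is at most `8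
m log (d / ε)`, while `4 ≤ a² C` makes the Hoeffding exponent at least `8 (m log (d / ε) + log (1 /
δ))`. -/
theorem card_signedSum_mul_exp_le {d m n : ℕ} (hdm : d = 0 → m = 0) {a C ε δ : ℝ} (hε : 0 < ε)
    (hε2 : ε ≤ 1 / 2) (hδ : 0 < δ) (hδ1 : δ ≤ 1) (hC : 4 ≤ a ^ 2 * C)
    (hn : C * ((m * Real.log (d / ε) + Real.log (1 / δ)) / ε ^ 2) ≤ n) :
    (Fintype.card (Fin (2 * (m + m)) → Option (Fin d × Bool)) : ℝ) *
      Real.exp (-2 * (a * ε) ^ 2 * n) ≤ δ := by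
  have hcard : (Fintype.card (Fin (2 * (m + m)) → Option (Fin d × Bool)) : ℝ) =
      Real.exp (4 * m * Real.log (2 * d + 1)) := by
    rw [Fintype.card_fun, Fintype.card_option, Fintype.card_prod, Fintype.card_fin,
      Fintype.card_bool, Fintype.card_fin]
    have : (4 * m * Real.log (2 * d + 1)) = ((2 * (m + m) : ℕ) : ℝ) * Real.log (2 * d + 1) := by
      push_cast; ring
    rw [this, Real.exp_nat_mul, Real.exp_log (by positivity)]
    push_cast
    ring
  have hlog : 0 ≤ m * Real.log (d / ε) ∧
      m * Real.log (2 * d + 1) ≤ 2 * (m * Real.log (d / ε)) := by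
    rcases Nat.eq_zero_or_pos d with hd | hd
    · simp [hdm hd]
    · have hd1 : (1 : ℝ) ≤ d := by exact_mod_cast hd
      have h2d : 2 * (d : ℝ) ≤ d / ε := by rw [le_div_iff₀ hε]; nlinarith
      have h1 : 0 ≤ Real.log (d / ε) := Real.log_nonneg (by linarith)
      refine ⟨by positivity, ?_⟩
      have h2 : Real.log (2 * d + 1) ≤ 2 * Real.log (d / ε) := by
        rw [← Nat.cast_ofNat, ← Real.log_pow]
        apply Real.log_le_log (by positivity)
        push_cast
        nlinarith
      calc m * Real.log (2 * d + 1) ≤ m * (2 * Real.log (d / ε)) := by gcongr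
        _ = _ := by ring
  have hδlog : 0 ≤ Real.log (1 / δ) := Real.log_nonneg (by rw [le_div_iff₀ hδ]; linarith)
  set W := m * Real.log (d / ε) + Real.log (1 / δ) with hW
  have hW0 : 0 ≤ W := by linarith [hlog.1]
  have h1 : 8 * W ≤ 2 * (a * ε) ^ 2 * n := by
    calc 8 * W ≤ 2 * (a ^ 2 * C) * W := by gcongr; linarith
      _ = 2 * (a * ε) ^ 2 * (C * (W / ε ^ 2)) := by field_simp
      _ ≤ _ := by gcongr
  rw [hcard, ← Real.exp_add, ← Real.le_log_iff_exp_le hδ]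
  have h2 : Real.log (1 / δ) = -Real.log δ := by rw [one_div, Real.log_inv]
  rw [← neg_neg (Real.log δ), ← h2]
  linarith [hlog.1, hlog.2]

theorem effectiveSparsity_le (d : ℕ) (q ε s : ℝ) : effectiveSparsity d q ε s ≤ d := by
  rcases Set.eq_empty_or_nonempty
    {u : ℕ | 1 ≤ u ∧ u ≤ d ∧ ε ^ 2 * (u : ℝ) ^ (2 / q - 1) ≤ s ^ 2} with h | h
  · rw [effectiveSparsity, h]; simp
  · exact csSup_le h fun u hu => hu.2.1

theorem mainTheorem3 (ε₀ : ℝ) (hε₀ : ε₀ < 1 / 2) :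
    ∃ C : ℝ, 0 < C ∧
      ∀ (q : ℝ), 0 < q → q < 2 →
      ∀ (ε : ℝ), 0 < ε → ε ≤ ε₀ →
      ∀ (δ : ℝ), 0 < δ →
      ∀ (d : ℕ) (s : ℝ) (n : ℕ),
        C * (((effectiveSparsity d q ε s : ℝ) * Real.log (d / ε) + Real.log (1 / δ)) / ε ^ 2) ≤ n →
        ∃ A : (Fin n → EuclideanSpace ℝ (Fin d)) → EuclideanSpace ℝ (Fin d),
          Measurable A ∧
          ∀ μ : EuclideanSpace ℝ (Fin d), lqNorm q μ ≤ s →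
            EstimatesMeanUnderCorruption.{u} A μ ε δ (C * ε) := by
  rcases le_or_gt ε₀ 0 with h0 | h0
  · exact ⟨1, one_pos, fun q _ _ ε hε hle => absurd (hε.trans_le hle) (not_lt.2 h0)⟩
  obtain ⟨a, t, ha, ht, htail⟩ := exists_gaussianReal_Ioi_le h0 hε₀
  -- With `T = (t + 2) ε`, the distance from the output to the reference candidate is at most `4 T =
  -- (4 t + 8) ε`, and from there to `μ` at most `2 ε`. The term `4 / a ^ 2` serves only the sample
  -- size.
  refine ⟨(4 * t + 10) + 4 / a ^ 2, by positivity, ?_⟩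
  intro q hq hq2 ε hε hεle δ hδ d s n hn
  set m := effectiveSparsity d q ε s with hm
  set V := signedSum (d := d) (L := 2 * (m + m)) with hV
  obtain ⟨A, hAm, hAS, hA⟩ := exists_measurable_compatible_selection (n := n) V (t * ε + 2 * ε)
    (S := {u : EuclideanSpace ℝ (Fin d) | supportCard u ≤ m}) ⟨0, by simp [supportCard]⟩
  refine ⟨A, hAm, fun μ hμ Ω _ P _ X Y hlaw hind hcorr => ?_⟩
  rcases le_or_gt 1 δ with hδ1 | hδ1
  · exact prob_le_one.trans (by rwa [ENNReal.one_le_ofReal])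
  obtain ⟨u₀, hu₀m, hu₀⟩ := exists_sparse_approx hq hq2 hε hμ
  obtain ⟨u, hum, hu₀u, hAu⟩ := hA u₀ hu₀m ε hε
  -- One `ε` comes from sparsification, the other from passing to a countable dense set of
  -- candidates.
  have hμu : ‖μ - u‖ ≤ 2 * ε := by
    rw [← sub_add_sub_cancel μ u₀ u]
    refine (norm_add_le _ _).trans ?_
    linarith
  -- The larger event involves only the clean samples, so the adversary may be arbitrary and
  -- non-measurable.
  have hbad : {ω | ((4 * t + 10) + 4 / a ^ 2) * ε < ‖A (fun i => Y i ω) - μ‖} ⊆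
      {ω | ∃ j, (1 / 2 - (1 + a) * ε + a * ε) * n ≤
        ({i | t * ε * ‖V j‖ < inner ℝ (X i ω - μ) (V j)} : Set (Fin n)).ncard} := by
    intro ω hω
    by_contra hc
    simp only [Set.mem_ofPred_eq, not_exists, not_le] at hc hω
    have hcomp : IsCompatible V (t * ε + 2 * ε) (fun i => Y i ω) u :=
      isCompatible_of_isCorruption (hcorr ω) (fun j => (hc j).trans_eq (by ring)) hμu
    have h1 := (hAu _ hcomp).norm_sub_le (by positivity) hcomp (hAS _) hum
    have h2 := norm_sub_le_norm_sub_add_norm_sub (A fun i => Y i ω) u μ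
    rw [norm_sub_rev u μ] at h2
    have h3 : 0 ≤ 4 / a ^ 2 * ε := by positivity
    linarith
  refine (measure_mono hbad).trans ?_
  rw [← ofReal_measureReal]
  refine ENNReal.ofReal_le_ofReal ((measureReal_exists_card_ge_le hlaw hind V (by positivity)
    (htail ε hε hεle)).trans ?_)
  refine card_signedSum_mul_exp_le (fun hd => ?_) hε (by linarith) hδ hδ1.le ?_ hn
  · have := effectiveSparsity_le d q ε s
    omega
  · have : a ^ 2 * (4 * t + 10 + 4 / a ^ 2) = a ^ 2 * (4 * t + 10) + 4 := by field_simp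
    rw [this]
    have : 0 ≤ a ^ 2 * (4 * t + 10) := by positivity
    linarith
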